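/- Let $\mathbb C$ be a (Barr-)exact category, i.e. a finitely complete category in which every morphism factors as a regular epimorphism followed by a monomorphism, regular epimorphisms are pullback-stable, and every internal equivalence relation is a kernel pair. Let $\mathsf{PreOrd}(\mathbb C)$ be the category of internal preorders in $\mathbb C$: an object $(A,\rho)$ is a reflexive and transitive relation $\langle r_1,r_2\rangle\colon\rho\rightarrowtail A\times A$, and a morphism $(f,\overline f)\colon(A,\rho)\to(B,\sigma)$, where $\langle s_1,s_2\rangle\colon\sigma\rightarrowtail B\times B$, is a pair of arrows $f\colon A\to B$, $\overline f\colon\rho\to\sigma$ with $f r_i=s_i\overline f$ for $i=1,2$. For a preorder $(A,\rho)$ let $\sim_\rho\,=\rho\wedge\rho^{o}$ be the equivalence relation on $A$ given by the pullback of $\langle r_1,r_2\rangle$ and $\langle r_2,r_1\rangle$ over $A\times A$, and let $A/{\sim_\rho}$ be the coequalizer of its two projections to $A$. Let $\mathsf{ParOrd}(\mathbb C)$ be the full subcategory of internal partial orders, i.e. of those preorders $(A,\rho)$ for which $\sim_\rho$ is the discrete relation $\langle 1_A,1_A\rangle\colon A\to A\times A$. The inclusion $U\colon\mathsf{ParOrd}(\mathbb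 C)\to\mathsf{PreOrd}(\mathbb C)$ has a left adjoint. Let $F\dashv U$ be any left adjoint, let $\mathcal E$ be the class of morphisms of $\mathsf{PreOrd}(\mathbb C)$ inverted by $F$, and let $\mathcal M$ be the closure under pullbacks in $\mathsf{PreOrd}(\mathbb C)$ of the class of morphisms lying in $\mathsf{ParOrd}(\mathbb C)$. Then $(\mathcal E,\mathcal M)$ is an (orthogonal) factorization system in $\mathsf{PreOrd}(\mathbb C)$, and for every morphism $(f,\overline f)\colon(A,\rho)\to(B,\sigma)$ in $\mathsf{PreOrd}(\mathbb C)$: (a) $(f,\overline f)$ lies in $\mathcal E$ if and only if it is fully faithful, i.e. the square $\langle s_1,s_2\rangle\,\overline f=(f\times f)\,\langle r_1,r_2\rangle$ is a pullback, and the induced arrow $A/{\sim_\rho}\to B/{\sim_\sigma}$ is a regular epimorphism. (b) $(f,\overline f)$ lies in $\mathcal M$ if and only if both commutative squares formed by $f$, the induced arrow $\hat f\colon{\sim_\rho}\to{\sim_\sigma}$ and, respectively, the first projections ${\sim_\rho}\to A$, ${\sim_\sigma}\to B$ and the second projections ${\sim_\rho}\to A$, ${\sim_\sigma}\to B$ are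 pullbacks; equivalently, if and only if the internal functor $(f,\hat f)\colon(A,\sim_\rho)\to(B,\sim_\sigma)$ is a discrete fibration, i.e. the square of second (codomain) projections is a pullback. -/

import Mathlib

open CategoryTheory CategoryTheory.Limits

universe v u v' u'

/-- A (Barr-)exact category: a regular category (finitely complete, with regular epi/mono
factorizations and pullback-stable regular epimorphisms) in which every internal equivalence
relation is effective, i.e. is the kernel pair of some arrow. -/
class BarrExact (C : Type u) [Category.{v} C] : Prop extends Regular C where
  effective : ∀ {R X : C} (r₁ r₂ : R ⟶ X), IsEquivalenceRelation r₁ r₂ →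
    ∃ (Y : C) (f : X ⟶ Y), IsKernelPair f r₁ r₂

/-- An internal preorder `(A, ρ)`: a jointly monic pair `r₁, r₂ : ρ ⟶ A` which is reflexive and
transitive. -/
structure InternalPreorder (C : Type u) [Category.{v} C] where
  /-- the underlying object `A` -/
  carrier : C
  /-- the object `ρ` of the relation -/
  rel : C
  r₁ : rel ⟶ carrier
  r₂ : rel ⟶ carrier
  reflexive : Nonempty (ReflexiveRelation r₁ r₂)
  transitive : Nonempty (TransitiveRelation r₁ r₂)

namespace InternalPreorder

section

variable {C : Type u} [Category.{v} C]

/-- A morphism of internal preorders: a pair of arrows commuting with both projections. -/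
@[ext]
structure Hom (A B : InternalPreorder C) where
  /-- the arrow `f` between the underlying objects -/
  base : A.carrier ⟶ B.carrier
  /-- the arrow between the relations -/
  onRel : A.rel ⟶ B.rel
  w₁ : A.r₁ ≫ base = onRel ≫ B.r₁
  w₂ : A.r₂ ≫ base = onRel ≫ B.r₂

/-- The category `PreOrd(C)` of internal preorders in `C`. -/
instance : Category (InternalPreorder C) where
  Hom := Hom
  id A := ⟨𝟙 _, 𝟙 _, by simp, by simp⟩
  comp f g := ⟨f.base ≫ g.base, f.onRel ≫ g.onRel,
    by rw [← Category.assoc, f.w₁, Category.assoc, g.w₁, Category.assoc],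
    by rw [← Category.assoc, f.w₂, Category.assoc, g.w₂, Category.assoc]⟩
  id_comp f := Hom.ext (Category.id_comp _) (Category.id_comp _)
  comp_id f := Hom.ext (Category.comp_id _) (Category.comp_id _)
  assoc f g h := Hom.ext (Category.assoc _ _ _) (Category.assoc _ _ _)

/-- An internal functor between internal preorders (a pair `x ρ y` being read as an arrow from `x`
to `y`) is a discrete fibration if the square on the codomain projections is a pullback. -/
def IsDiscreteFibration {A B : InternalPreorder C} (f : A ⟶ B) : Prop :=
  IsPullback f.onRel A.r₂ B.r₂ f.base

/-- Transitivity of `ρ` on generalized elements. -/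
lemma exists_trans (A : InternalPreorder C) {T : C} (a b : T ⟶ A.rel)
    (h : a ≫ A.r₂ = b ≫ A.r₁) :
    ∃ c : T ⟶ A.rel, c ≫ A.r₁ = a ≫ A.r₁ ∧ c ≫ A.r₂ = b ≫ A.r₂ := by
  obtain ⟨t⟩ := A.transitive
  have e₁ : PullbackCone.IsLimit.lift t.isLimit a b h ≫ t.c.fst = a :=
    PullbackCone.IsLimit.lift_fst ..
  have e₂ : PullbackCone.IsLimit.lift t.isLimit a b h ≫ t.c.snd = b :=
    PullbackCone.IsLimit.lift_snd ..
  refine ⟨PullbackCone.IsLimit.lift t.isLimit a b h ≫ t.t, ?_, ?_⟩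
  · rw [Category.assoc, t.transitivity₁, ← Category.assoc, e₁]
  · rw [Category.assoc, t.transitivity₂, ← Category.assoc, e₂]

end

noncomputable section

variable {C : Type u} [Category.{v} C] [HasFiniteLimits C]

/-- The relation `ρ` as an arrow `⟨r₁, r₂⟩ : ρ ⟶ A × A`. -/
def pair (A : InternalPreorder C) : A.rel ⟶ A.carrier ⨯ A.carrier :=
  prod.lift A.r₁ A.r₂

/-- The opposite relation `ρᵒ` as an arrow `⟨r₂, r₁⟩ : ρ ⟶ A × A`. -/
def oppPair (A : InternalPreorder C) : A.rel ⟶ A.carrier ⨯ A.carrier :=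
  prod.lift A.r₂ A.r₁

/-- The object `∼ρ = ρ ∧ ρᵒ`, the pullback of `ρ` and `ρᵒ` over `A × A`. -/
def simObj (A : InternalPreorder C) : C :=
  pullback A.pair A.oppPair

/-- The projection `∼ρ ⟶ ρ`. -/
def simFst (A : InternalPreorder C) : A.simObj ⟶ A.rel :=
  pullback.fst A.pair A.oppPair

/-- The projection `∼ρ ⟶ ρᵒ`. -/
def simSnd (A : InternalPreorder C) : A.simObj ⟶ A.rel :=
  pullback.snd A.pair A.oppPair

/-- The first projection `∼ρ ⟶ A`. -/
def sim₁ (A : InternalPreorder C) : A.simObj ⟶ A.carrier :=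
  A.simFst ≫ A.r₁

/-- The second projection `∼ρ ⟶ A`. -/
def sim₂ (A : InternalPreorder C) : A.simObj ⟶ A.carrier :=
  A.simFst ≫ A.r₂

lemma simFst_pair (A : InternalPreorder C) : A.simFst ≫ A.pair = A.simSnd ≫ A.oppPair :=
  pullback.condition

lemma simSnd_r₂ (A : InternalPreorder C) : A.simSnd ≫ A.r₂ = A.sim₁ := by
  have h₁ : A.pair ≫ prod.fst = A.r₁ := prod.lift_fst _ _
  have h₂ : A.oppPair ≫ prod.fst = A.r₂ := prod.lift_fst _ _
  rw [sim₁, ← h₁, ← h₂, ← Category.assoc, ← Category.assoc, simFst_pair]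

lemma simSnd_r₁ (A : InternalPreorder C) : A.simSnd ≫ A.r₁ = A.sim₂ := by
  have h₁ : A.pair ≫ prod.snd = A.r₂ := prod.lift_snd _ _
  have h₂ : A.oppPair ≫ prod.snd = A.r₁ := prod.lift_snd _ _
  rw [sim₂, ← h₁, ← h₂, ← Category.assoc, ← Category.assoc, simFst_pair]

/-- Two generalized elements `x, y` of `A` with `x ρ y` and `y ρ x` satisfy `x ∼ρ y`. -/
lemma exists_sim_lift (A : InternalPreorder C) {T : C} (a b : T ⟶ A.rel)
    (h₁ : a ≫ A.r₁ = b ≫ A.r₂) (h₂ : a ≫ A.r₂ = b ≫ A.r₁) :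
    ∃ l : T ⟶ A.simObj, l ≫ A.sim₁ = a ≫ A.r₁ ∧ l ≫ A.sim₂ = a ≫ A.r₂ := by
  have h : a ≫ A.pair = b ≫ A.oppPair := by
    apply Limits.prod.hom_ext <;> simp [pair, oppPair, h₁, h₂]
  have hl : pullback.lift a b h ≫ A.simFst = a := pullback.lift_fst a b h
  refine ⟨pullback.lift a b h, ?_, ?_⟩
  · rw [sim₁]
    exact (Category.assoc _ _ _).symm.trans (congrArg (· ≫ A.r₁) hl)
  · rw [sim₂]
    exact (Category.assoc _ _ _).symm.trans (congrArg (· ≫ A.r₂) hl)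

/-- `∼ρ` is an internal equivalence relation. -/
lemma sim_equivalence (A : InternalPreorder C) :
    Nonempty (EquivalenceRelation A.sim₁ A.sim₂) := by
  obtain ⟨e⟩ := A.reflexive
  have jm := e.right_cancellation
  have hmono : ∀ ⦃Y : C⦄ (f g : Y ⟶ A.simObj), f ≫ A.sim₁ = g ≫ A.sim₁ →
      f ≫ A.sim₂ = g ≫ A.sim₂ → f = g := by
    intro Y f g h₁ h₂
    refine pullback.hom_ext (jm (f ≫ A.simFst) (g ≫ A.simFst) ?_ ?_)
      (jm (f ≫ A.simSnd) (g ≫ A.simSnd) ?_ ?_)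
    · simpa only [sim₁, Category.assoc] using h₁
    · simpa only [sim₂, Category.assoc] using h₂
    · simpa only [simSnd_r₁, Category.assoc] using h₂
    · simpa only [simSnd_r₂, Category.assoc] using h₁
  obtain ⟨r, hr₁, hr₂⟩ := A.exists_sim_lift e.r e.r (by simp) (by simp)
  obtain ⟨s, hs₁, hs₂⟩ := A.exists_sim_lift A.simSnd A.simFst
    (by rw [simSnd_r₁]; rfl) (by rw [simSnd_r₂]; rfl)
  rw [simSnd_r₁] at hs₁
  rw [simSnd_r₂] at hs₂
  have hp := pullback.condition (f := A.sim₂) (g := A.sim₁)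
  obtain ⟨a, ha₁, ha₂⟩ := A.exists_trans (pullback.fst A.sim₂ A.sim₁ ≫ A.simFst)
    (pullback.snd A.sim₂ A.sim₁ ≫ A.simFst) (by rw [Category.assoc, Category.assoc]; exact hp)
  obtain ⟨b, hb₁, hb₂⟩ := A.exists_trans (pullback.snd A.sim₂ A.sim₁ ≫ A.simSnd)
    (pullback.fst A.sim₂ A.sim₁ ≫ A.simSnd)
    (by rw [Category.assoc, Category.assoc, simSnd_r₁, simSnd_r₂]; exact hp.symm)
  rw [Category.assoc] at ha₁ ha₂ hb₁ hb₂
  rw [simSnd_r₁] at hb₁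
  rw [simSnd_r₂] at hb₂
  obtain ⟨t, ht₁, ht₂⟩ := A.exists_sim_lift a b (ha₁.trans hb₂.symm) (ha₂.trans hb₁.symm)
  exact ⟨{
    right_cancellation := hmono
    r := r
    reflexivity₁ := hr₁.trans e.reflexivity₁
    reflexivity₂ := hr₂.trans e.reflexivity₂
    s := s
    symmetry₁ := hs₁
    symmetry₂ := hs₂
    c := pullback.cone A.sim₂ A.sim₁
    isLimit := pullback.isLimit A.sim₂ A.sim₁
    t := t
    transitivity₁ := ht₁.trans ha₁
    transitivity₂ := ht₂.trans ha₂ }⟩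

/-- The internal preorder (in fact equivalence relation) `(A, ∼ρ)`. -/
def sim (A : InternalPreorder C) : InternalPreorder C where
  carrier := A.carrier
  rel := A.simObj
  r₁ := A.sim₁
  r₂ := A.sim₂
  reflexive := A.sim_equivalence.map EquivalenceRelation.toReflexiveRelation
  transitive := A.sim_equivalence.map EquivalenceRelation.toTransitiveRelation

/-- `(A, ρ)` is an internal partial order: the subobject `∼ρ = ρ ∧ ρᵒ` of `A × A` is the discrete
relation `⟨1, 1⟩ : A ⟶ A × A`. -/
def isPartialOrder (C : Type u) [Category.{v} C] [HasFiniteLimits C] :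
    ObjectProperty (InternalPreorder C) := fun A =>
  ∃ i : A.simObj ≅ A.carrier,
    i.hom ≫ prod.lift (𝟙 A.carrier) (𝟙 A.carrier) = prod.lift A.sim₁ A.sim₂

/-- The category `ParOrd(C)` of internal partial orders, a full subcategory of `PreOrd(C)`. -/
abbrev ParOrd (C : Type u) [Category.{v} C] [HasFiniteLimits C] :=
  (isPartialOrder C).FullSubcategory

/-- The forgetful functor `U : ParOrd(C) ⥤ PreOrd(C)`. -/
abbrev forgetParOrd (C : Type u) [Category.{v} C] [HasFiniteLimits C] :
    ParOrd C ⥤ InternalPreorder C :=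
  (isPartialOrder C).ι

lemma Hom.pair_comp {A B : InternalPreorder C} (f : A ⟶ B) :
    A.pair ≫ prod.map f.base f.base = f.onRel ≫ B.pair := by
  simp [pair, f.w₁, f.w₂]

lemma Hom.oppPair_comp {A B : InternalPreorder C} (f : A ⟶ B) :
    A.oppPair ≫ prod.map f.base f.base = f.onRel ≫ B.oppPair := by
  simp [oppPair, f.w₁, f.w₂]

/-- The arrow `∼ρ ⟶ ∼σ` induced by a morphism of preorders `(A, ρ) ⟶ (B, σ)`. -/
def Hom.simRel {A B : InternalPreorder C} (f : A ⟶ B) : A.simObj ⟶ B.simObj :=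
  pullback.map A.pair A.oppPair B.pair B.oppPair f.onRel f.onRel
    (prod.map f.base f.base) (Hom.pair_comp f) (Hom.oppPair_comp f)

lemma Hom.simRel_simFst {A B : InternalPreorder C} (f : A ⟶ B) :
    Hom.simRel f ≫ B.simFst = A.simFst ≫ f.onRel :=
  pullback.lift_fst _ _ _

lemma Hom.sim_w₁ {A B : InternalPreorder C} (f : A ⟶ B) :
    A.sim₁ ≫ f.base = Hom.simRel f ≫ B.sim₁ := by
  rw [sim₁, sim₁, Category.assoc, f.w₁, ← Category.assoc, ← Category.assoc, simRel_simFst]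

lemma Hom.sim_w₂ {A B : InternalPreorder C} (f : A ⟶ B) :
    A.sim₂ ≫ f.base = Hom.simRel f ≫ B.sim₂ := by
  rw [sim₂, sim₂, Category.assoc, f.w₂, ← Category.assoc, ← Category.assoc, simRel_simFst]

/-- The internal functor `(A, ∼ρ) ⟶ (B, ∼σ)` induced by a morphism of preorders. -/
def simMap {A B : InternalPreorder C} (f : A ⟶ B) : A.sim ⟶ B.sim where
  base := f.base
  onRel := Hom.simRel f
  w₁ := Hom.sim_w₁ f
  w₂ := Hom.sim_w₂ f

/-- A morphism of preorders is fully faithful if `ρ` is the inverse image of `σ`, i.e. the square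
with `f × f` is a pullback. -/
def IsFullyFaithful {A B : InternalPreorder C} (f : A ⟶ B) : Prop :=
  IsPullback f.onRel A.pair B.pair (prod.map f.base f.base)

end

noncomputable section

variable {C : Type u} [Category.{v} C] [BarrExact C]

instance hasCoequalizer_sim (A : InternalPreorder C) : HasCoequalizer A.sim₁ A.sim₂ := by
  obtain ⟨e⟩ := A.sim_equivalence
  obtain ⟨Y, f, hf⟩ := BarrExact.effective _ _ e.isEquivalenceRelation
  exact Regular.hasCoequalizer_of_isKernelPair hf

/-- The quotient `A/∼ρ`, the coequalizer of the two projections of `∼ρ`. -/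
def quot (A : InternalPreorder C) : C :=
  coequalizer A.sim₁ A.sim₂

/-- The canonical quotient map `A ⟶ A/∼ρ`. -/
def quotπ (A : InternalPreorder C) : A.carrier ⟶ A.quot :=
  coequalizer.π A.sim₁ A.sim₂

/-- The induced arrow `A/∼ρ ⟶ B/∼σ`, the unique one compatible with the quotient maps. -/
def quotMap {A B : InternalPreorder C} (f : A ⟶ B) : A.quot ⟶ B.quot :=
  coequalizer.desc (f.base ≫ B.quotπ) (by
    rw [← Category.assoc, ← Category.assoc, Hom.sim_w₁, Hom.sim_w₂, Category.assoc, Category.assoc]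
    exact congrArg (Hom.simRel f ≫ ·) (coequalizer.condition B.sim₁ B.sim₂))

lemma quotπ_quotMap {A B : InternalPreorder C} (f : A ⟶ B) :
    A.quotπ ≫ quotMap f = f.base ≫ B.quotπ :=
  coequalizer.π_desc _ _

/-- The class `ℰ` of morphisms of `PreOrd(C)` inverted by a functor `F` to `ParOrd(C)`. -/
def classE (F : InternalPreorder C ⥤ ParOrd C) : MorphismProperty (InternalPreorder C) :=
  (MorphismProperty.isomorphisms (ParOrd C)).inverseImage F

/-- The class `ℳ`, the closure under pullbacks (in `PreOrd(C)`) of the morphisms lying in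
`ParOrd(C)`. -/
def classM (C : Type u) [Category.{v} C] [BarrExact C] : MorphismProperty (InternalPreorder C) :=
  (MorphismProperty.ofObjectProperty (isPartialOrder C) (isPartialOrder C)).pullbacks

end

end InternalPreorder

/-- `e` is orthogonal to `m`: every commutative square from `e` to `m` has a unique diagonal. -/
def IsOrthogonal {D : Type u'} [Category.{v'} D] {A B X Y : D} (e : A ⟶ B) (m : X ⟶ Y) : Prop :=
  ∀ (a : A ⟶ X) (b : B ⟶ Y), a ≫ m = e ≫ b → ∃! d : B ⟶ X, e ≫ d = a ∧ d ≫ m = b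

/-- `(E, M)` is an (orthogonal) factorization system: each class consists exactly of the morphisms
orthogonal to the other one, and each morphism factors as one in `E` followed by one in `M`. -/
structure IsFactorizationSystem {D : Type u'} [Category.{v'} D] (E M : MorphismProperty D) :
    Prop where
  left_iff : ∀ {A B : D} (e : A ⟶ B),
    E e ↔ ∀ {X Y : D} (m : X ⟶ Y), M m → IsOrthogonal e m
  right_iff : ∀ {X Y : D} (m : X ⟶ Y),
    M m ↔ ∀ {A B : D} (e : A ⟶ B), E e → IsOrthogonal e m
  factorization : E.HasFactorization M

/-! The reflection of `(A, ρ)` is `A/∼ρ` ordered by the image of `ρ`. Exactness makes `∼ρ` the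
kernel pair of the quotient map (`comp_quotπ_eq_iff`), so the unit both reflects and preserves the
order (`le_toReflection_iff`) and has a regular epimorphism as underlying arrow. Arguments run on
generalized elements: an inequality may be checked after a strong epimorphic cover
(`Le.of_strongEpi`), and on a cover elements of a quotient have representatives.

Units lie in `ℰ`, so by two-out-of-three `f` is in `ℰ` exactly when `reflectionMap f` is invertible;
unwinding this through the units gives (a). For (b), the discrete fibration condition says that the
unit's naturality square at `f` is a pullback (`isPullback_toReflection`). Conversely, a pullback of
a morphism of partial orders has unique lifts of equivalences, since equivalent elements become
equal in a partial order.

By adjunction, `ℰ` is orthogonal to morphisms of partial orders, hence to their pullbacks. To factor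
`f`, pull `reflectionMap f` back along the unit of `B`. The projection to the reflection of `A` is a
pullback of that unit, hence fully faithful with regular epimorphic base, so in `ℰ` by (a).
Two-out-of-three then puts the comparison from `A` in `ℰ`. -/

section

variable {D : Type u'} [Category.{v'} D]

/-- A square is a pullback if compatible pairs of generalized elements lift and the projections are
jointly monic. -/
lemma CategoryTheory.IsPullback.of_exists_lift {P X Y Z : D} {fst : P ⟶ X} {snd : P ⟶ Y}
    {f : X ⟶ Z} {g : Y ⟶ Z} (w : fst ≫ f = snd ≫ g)
    (ex : ∀ {T : D} (a : T ⟶ X) (b : T ⟶ Y), a ≫ f = b ≫ g →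
      ∃ l : T ⟶ P, l ≫ fst = a ∧ l ≫ snd = b)
    (un : ∀ {T : D} (l l' : T ⟶ P), l ≫ fst = l' ≫ fst → l ≫ snd = l' ≫ snd → l = l') :
    IsPullback fst snd f g := by
  choose l h₁ h₂ using fun s : PullbackCone f g => ex s.fst s.snd s.condition
  exact ⟨⟨w⟩, ⟨PullbackCone.IsLimit.mk w l h₁ h₂ fun s m e₁ e₂ =>
    un _ _ (e₁.trans (h₁ s).symm) (e₂.trans (h₂ s).symm)⟩⟩

/-! ### Orthogonality in an arbitrary category. -/

namespace IsOrthogonal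

/-- If `e'` and `e' ≫ m` are orthogonal to `m`, then `m` is invertible. -/
lemma isIso_right {A B X : D} {e' : A ⟶ X} {m : X ⟶ B} (h' : IsOrthogonal e' m)
    (h : IsOrthogonal (e' ≫ m) m) : IsIso m := by
  -- The diagonal `d` is a section of `m`; both `m ≫ d` and the identity are diagonals of the square
  -- from `e'` to `m`, so they agree.
  obtain ⟨d, ⟨h₁, h₂⟩, -⟩ := h e' (𝟙 B) (by simp)
  refine ⟨d, (h' e' m rfl).unique ⟨?_, ?_⟩ ⟨Category.comp_id _, Category.id_comp _⟩, h₂⟩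
  · rw [← Category.assoc, h₁]
  · rw [Category.assoc, h₂, Category.comp_id]

/-- If `e` is orthogonal to both `m'` and `e ≫ m'`, then `e` is invertible. -/
lemma isIso_left {A B X : D} {e : A ⟶ X} {m' : X ⟶ B} (h' : IsOrthogonal e m')
    (h : IsOrthogonal e (e ≫ m')) : IsIso e := by
  obtain ⟨d, ⟨h₁, h₂⟩, -⟩ := h (𝟙 A) m' (by simp)
  refine ⟨d, h₁, (h' e m' rfl).unique ⟨?_, ?_⟩ ⟨Category.comp_id _, Category.id_comp _⟩⟩
  · rw [← Category.assoc, h₁, Category.id_comp]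
  · rw [Category.assoc, h₂]

/-- Orthogonality is stable under pullback of the right-hand morphism. -/
lemma of_isPullback {A B X Y X' Y' : D} {e : A ⟶ B} {m : X ⟶ Y} {m' : X' ⟶ Y'} {k : X' ⟶ X}
    {h : Y' ⟶ Y} (H : IsOrthogonal e m) (sq : IsPullback k m' m h) : IsOrthogonal e m' := by
  intro a b w
  obtain ⟨d, ⟨h₁, h₂⟩, hu⟩ := H (a ≫ k) (b ≫ h) (by
    rw [Category.assoc, sq.w, ← Category.assoc, w, Category.assoc])
  refine ⟨sq.lift d b h₂, ⟨sq.hom_ext ?_ ?_, sq.lift_snd _ _ _⟩, fun d' hd' => sq.hom_ext ?_ ?_⟩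
  · rw [Category.assoc, sq.lift_fst, h₁]
  · rw [Category.assoc, sq.lift_snd, w]
  · rw [sq.lift_fst]
    refine hu _ ⟨?_, ?_⟩
    · rw [← Category.assoc, hd'.1]
    · rw [Category.assoc, sq.w, ← Category.assoc, hd'.2]
  · rw [sq.lift_snd, hd'.2]

end IsOrthogonal

/-- Orthogonal classes closed under isomorphisms which provide factorizations form a factorization
system. -/
lemma IsFactorizationSystem.of_isOrthogonal {E M : MorphismProperty D} [E.RespectsIso]
    [M.RespectsIso] (fac : E.HasFactorization M)
    (orth : ∀ {A B X Y : D} (e : A ⟶ B) (m : X ⟶ Y), E e → M m → IsOrthogonal e m) :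
    IsFactorizationSystem E M where
  left_iff e := by
    refine ⟨fun he X Y m hm => orth e m he hm, fun H => ?_⟩
    obtain ⟨⟨Z, i, p, rfl, hi, hp⟩⟩ := fac.nonempty_mapFactorizationData e
    have := (orth i p hi hp).isIso_right (H p hp)
    exact (E.cancel_right_of_respectsIso i p).2 hi
  right_iff m := by
    refine ⟨fun hm A B e he => orth e m he hm, fun H => ?_⟩
    obtain ⟨⟨Z, i, p, rfl, hi, hp⟩⟩ := fac.nonempty_mapFactorizationData m
    have := (orth i p hi hp).isIso_left (H i hi)
    exact (M.cancel_left_of_respectsIso i p).2 hp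
  factorization := fac

end

namespace InternalPreorder

attribute [local simp] prod.lift_fst prod.lift_snd prod.lift_fst_assoc prod.lift_snd_assoc

/-! ### Preorders on generalized elements. -/

section

variable {C : Type u} [Category.{v} C]

@[simp]
lemma id_base (A : InternalPreorder C) : Hom.base (𝟙 A) = 𝟙 A.carrier := rfl

@[simp]
lemma comp_base {A B D : InternalPreorder C} (f : A ⟶ B) (g : B ⟶ D) :
    (f ≫ g).base = f.base ≫ g.base := rfl

lemma jointlyMono (A : InternalPreorder C) : JointlyMono₂ A.r₁ A.r₂ :=
  A.reflexive.some.toJointlyMono₂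

-- Since the relation is jointly monic, being a morphism is a property of the underlying arrow.
@[ext]
lemma hom_ext {A B : InternalPreorder C} {f g : A ⟶ B} (h : f.base = g.base) : f = g :=
  Hom.ext h (B.jointlyMono.right_cancellation _ _ (by rw [← f.w₁, ← g.w₁, h])
    (by rw [← f.w₂, ← g.w₂, h]))

lemma congr_base {A B : InternalPreorder C} {f g : A ⟶ B} (h : f = g) : f.base = g.base := by
  rw [h]

/-- The preorder on generalized elements. -/
def Le (A : InternalPreorder C) {T : C} (a b : T ⟶ A.carrier) : Prop :=
  ∃ r : T ⟶ A.rel, r ≫ A.r₁ = a ∧ r ≫ A.r₂ = b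

/-- The equivalence relation on generalized elements. -/
def Equiv (A : InternalPreorder C) {T : C} (a b : T ⟶ A.carrier) : Prop :=
  A.Le a b ∧ A.Le b a

variable {A B : InternalPreorder C}

lemma le_r (A : InternalPreorder C) : A.Le A.r₁ A.r₂ :=
  ⟨𝟙 _, by simp, by simp⟩

lemma Le.refl {T : C} (a : T ⟶ A.carrier) : A.Le a a :=
  ⟨a ≫ A.reflexive.some.r, by simp, by simp⟩

lemma Le.trans {T : C} {a b c : T ⟶ A.carrier} (h : A.Le a b) (h' : A.Le b c) : A.Le a c := by
  obtain ⟨r, rfl, rfl⟩ := h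
  obtain ⟨s, hs, rfl⟩ := h'
  exact A.exists_trans r s hs.symm

lemma Le.comp {S T : C} {a b : T ⟶ A.carrier} (h : A.Le a b) (p : S ⟶ T) :
    A.Le (p ≫ a) (p ≫ b) := by
  obtain ⟨r, rfl, rfl⟩ := h
  exact ⟨p ≫ r, by simp, by simp⟩

lemma Le.map {T : C} {a b : T ⟶ A.carrier} (h : A.Le a b) (f : A ⟶ B) :
    B.Le (a ≫ f.base) (b ≫ f.base) := by
  obtain ⟨r, rfl, rfl⟩ := h
  exact ⟨r ≫ f.onRel, by rw [Category.assoc, Category.assoc, f.w₁],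
    by rw [Category.assoc, Category.assoc, f.w₂]⟩

lemma Equiv.refl {T : C} (a : T ⟶ A.carrier) : A.Equiv a a :=
  ⟨.refl a, .refl a⟩

lemma Equiv.symm {T : C} {a b : T ⟶ A.carrier} (h : A.Equiv a b) : A.Equiv b a :=
  ⟨h.2, h.1⟩

lemma Equiv.trans {T : C} {a b c : T ⟶ A.carrier} (h : A.Equiv a b) (h' : A.Equiv b c) :
    A.Equiv a c :=
  ⟨h.1.trans h'.1, h'.2.trans h.2⟩

lemma Equiv.map {T : C} {a b : T ⟶ A.carrier} (h : A.Equiv a b) (f : A ⟶ B) :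
    B.Equiv (a ≫ f.base) (b ≫ f.base) :=
  ⟨h.1.map f, h.2.map f⟩

/-- A morphism of preorders from a monotone arrow. -/
noncomputable def homMk (f : A.carrier ⟶ B.carrier) (h : B.Le (A.r₁ ≫ f) (A.r₂ ≫ f)) : A ⟶ B where
  base := f
  onRel := h.choose
  w₁ := h.choose_spec.1.symm
  w₂ := h.choose_spec.2.symm

/-- A morphism of preorders is invertible if it reflects the preorder on generalized elements and
has invertible underlying arrow. -/
lemma isIso_of_reflects_le (f : A ⟶ B) [IsIso f.base]
    (h : ∀ {T : C} (a b : T ⟶ A.carrier), B.Le (a ≫ f.base) (b ≫ f.base) → A.Le a b) :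
    IsIso f :=
  ⟨homMk (inv f.base) (h _ _ (by simpa using B.le_r)), by ext; simp [homMk], by ext; simp [homMk]⟩

instance (f : A ⟶ B) [IsIso f] : IsIso f.base :=
  ⟨(inv f).base, by rw [← comp_base, IsIso.hom_inv_id, id_base],
    by rw [← comp_base, IsIso.inv_hom_id, id_base]⟩

/-- A square of preorders is a pullback if the underlying square is and the preorder is induced by
the projections. -/
lemma isPullback_of_base {P X Y Z : InternalPreorder C} {k : P ⟶ X} {f : P ⟶ Y} {g : X ⟶ Z}
    {h : Y ⟶ Z} (sq : IsPullback k.base f.base g.base h.base)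
    (hle : ∀ {T : C} (a b : T ⟶ P.carrier), X.Le (a ≫ k.base) (b ≫ k.base) →
      Y.Le (a ≫ f.base) (b ≫ f.base) → P.Le a b) :
    IsPullback k f g h := by
  refine IsPullback.of_exists_lift (hom_ext sq.w) (fun {T} a b w => ?_)
    fun l l' h₁ h₂ => hom_ext (sq.hom_ext (congr_base h₁) (congr_base h₂))
  have w' : a.base ≫ g.base = b.base ≫ h.base := congr_base w
  refine ⟨homMk (sq.lift a.base b.base w') (hle _ _ ?_ ?_), hom_ext (sq.lift_fst _ _ _),
    hom_ext (sq.lift_snd _ _ _)⟩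
  · rw [Category.assoc, Category.assoc, sq.lift_fst]
    exact T.le_r.map a
  · rw [Category.assoc, Category.assoc, sq.lift_snd]
    exact T.le_r.map b

/-- The discrete preorder on an object. -/
def discrete [HasPullbacks C] (X : C) : InternalPreorder C where
  carrier := X
  rel := X
  r₁ := 𝟙 X
  r₂ := 𝟙 X
  reflexive := ⟨{ r := 𝟙 X, right_cancellation := fun _ _ _ h _ => by simpa using h }⟩
  transitive := ⟨{
    right_cancellation := fun _ _ _ h _ => by simpa using h
    c := pullback.cone (𝟙 X) (𝟙 X)
    isLimit := pullback.isLimit (𝟙 X) (𝟙 X)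
    t := pullback.fst (𝟙 X) (𝟙 X)
    transitivity₁ := rfl
    transitivity₂ := pullback.condition }⟩

/-- The morphism out of a discrete preorder given by an arrow. -/
noncomputable def discreteHom [HasPullbacks C] {X : C} (x : X ⟶ A.carrier) : discrete X ⟶ A where
  base := x
  onRel := x ≫ A.reflexive.some.r
  w₁ := by simp [discrete]
  w₂ := by simp [discrete]

end

/-! ### Element-wise descriptions, induced preorders and pullbacks in `PreOrd(C)`. -/

noncomputable section

variable {C : Type u} [Category.{v} C] [HasFiniteLimits C] {A B : InternalPreorder C}

instance mono_pair (A : InternalPreorder C) : Mono A.pair where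
  right_cancellation f g h := A.jointlyMono.right_cancellation f g
    (by simpa [pair] using congr($h ≫ prod.fst)) (by simpa [pair] using congr($h ≫ prod.snd))

lemma le_iff_pair {T : C} (a b : T ⟶ A.carrier) :
    A.Le a b ↔ ∃ r : T ⟶ A.rel, r ≫ A.pair = prod.lift a b := by
  refine exists_congr fun r => ⟨fun h => ?_, fun h => ⟨?_, ?_⟩⟩
  · apply Limits.prod.hom_ext <;> simp [pair, h.1, h.2]
  · simpa [pair] using congr($h ≫ prod.fst)
  · simpa [pair] using congr($h ≫ prod.snd)

lemma equiv_iff_sim {T : C} (a b : T ⟶ A.carrier) :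
    A.Equiv a b ↔ ∃ l : T ⟶ A.simObj, l ≫ A.sim₁ = a ∧ l ≫ A.sim₂ = b := by
  constructor
  · rintro ⟨⟨r, rfl, rfl⟩, ⟨s, h₁, h₂⟩⟩
    exact A.exists_sim_lift r s h₂.symm h₁.symm
  · rintro ⟨l, rfl, rfl⟩
    exact ⟨⟨l ≫ A.simFst, by simp [sim₁], by simp [sim₂]⟩,
      ⟨l ≫ A.simSnd, by simp [simSnd_r₁], by simp [simSnd_r₂]⟩⟩

lemma equiv_sim (A : InternalPreorder C) : A.Equiv A.sim₁ A.sim₂ :=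
  (equiv_iff_sim _ _).2 ⟨𝟙 _, by simp, by simp⟩

lemma sim_hom_ext {T : C} {l l' : T ⟶ A.simObj} (h₁ : l ≫ A.sim₁ = l' ≫ A.sim₁)
    (h₂ : l ≫ A.sim₂ = l' ≫ A.sim₂) : l = l' :=
  A.sim_equivalence.some.toJointlyMono₂.right_cancellation _ _ h₁ h₂

/-- Antisymmetry on generalized elements. -/
lemma isPartialOrder_iff :
    isPartialOrder C A ↔ ∀ {T : C} (a b : T ⟶ A.carrier), A.Equiv a b → a = b := by
  constructor
  · rintro ⟨i, hi⟩ T a b h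
    obtain ⟨l, rfl, rfl⟩ := (equiv_iff_sim a b).1 h
    have h₁ : i.hom = A.sim₁ := by simpa using congr($hi ≫ prod.fst)
    have h₂ : i.hom = A.sim₂ := by simpa using congr($hi ≫ prod.snd)
    rw [← h₁, ← h₂]
  · intro h
    have h₁₂ := h _ _ A.equiv_sim
    obtain ⟨r, hr₁, hr₂⟩ := (equiv_iff_sim (𝟙 A.carrier) (𝟙 A.carrier)).1 (.refl _)
    refine ⟨⟨A.sim₁, r, sim_hom_ext ?_ ?_, hr₁⟩, ?_⟩
    · rw [Category.assoc, hr₁, Category.comp_id, Category.id_comp]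
    · rw [Category.assoc, hr₂, Category.comp_id, Category.id_comp, h₁₂]
    · apply Limits.prod.hom_ext <;> simp [← h₁₂]

/-- Full faithfulness on generalized elements. -/
lemma isFullyFaithful_iff (f : A ⟶ B) :
    IsFullyFaithful f ↔
      ∀ {T : C} (a b : T ⟶ A.carrier), B.Le (a ≫ f.base) (b ≫ f.base) → A.Le a b := by
  constructor
  · intro h T a b hab
    obtain ⟨s, hs⟩ := (le_iff_pair _ _).1 hab
    exact (le_iff_pair _ _).2 ⟨h.lift s (prod.lift a b) (by rw [hs, prod.lift_map]),
      h.lift_snd _ _ _⟩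
  · intro h
    refine IsPullback.of_exists_lift (Hom.pair_comp f).symm (fun s t w => ?_)
      fun l l' _ h₂ => (cancel_mono A.pair).1 h₂
    have ht : t = prod.lift (t ≫ prod.fst) (t ≫ prod.snd) := by
      apply Limits.prod.hom_ext <;> simp
    obtain ⟨r, hr⟩ := (le_iff_pair _ _).1 (h (t ≫ prod.fst) (t ≫ prod.snd)
      ((le_iff_pair _ _).2 ⟨s, by rw [w, ← prod.lift_map, ← ht]⟩))
    rw [← ht] at hr
    refine ⟨r, ?_, hr⟩
    rw [← cancel_mono B.pair, Category.assoc, ← Hom.pair_comp, w, ← hr, Category.assoc]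

/-- The internal preorder given by a subobject of `X × X` which is reflexive and transitive on
generalized elements. -/
def ofMono {X R : C} (m : R ⟶ X ⨯ X) [Mono m] (refl : ∃ r : X ⟶ R, r ≫ m = prod.lift (𝟙 X) (𝟙 X))
    (trans : ∀ {T : C} (a b c : T ⟶ X), (∃ r : T ⟶ R, r ≫ m = prod.lift a b) →
      (∃ r : T ⟶ R, r ≫ m = prod.lift b c) → ∃ r : T ⟶ R, r ≫ m = prod.lift a c) :
    InternalPreorder C where
  carrier := X
  rel := R
  r₁ := m ≫ prod.fst
  r₂ := m ≫ prod.snd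
  reflexive := by
    obtain ⟨r, hr⟩ := refl
    exact ⟨{
      right_cancellation := fun _ f g h₁ h₂ => (cancel_mono m).1
        (Limits.prod.hom_ext (by simpa using h₁) (by simpa using h₂))
      r := r
      reflexivity₁ := by rw [← Category.assoc, hr, prod.lift_fst]
      reflexivity₂ := by rw [← Category.assoc, hr, prod.lift_snd] }⟩
  transitive := by
    have hp := pullback.condition (f := m ≫ prod.snd) (g := m ≫ prod.fst)
    obtain ⟨t, ht⟩ := trans (pullback.fst (m ≫ prod.snd) (m ≫ prod.fst) ≫ m ≫ prod.fst)
      (pullback.fst (m ≫ prod.snd) (m ≫ prod.fst) ≫ m ≫ prod.snd)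
      (pullback.snd (m ≫ prod.snd) (m ≫ prod.fst) ≫ m ≫ prod.snd)
      ⟨pullback.fst _ _, by apply Limits.prod.hom_ext <;> simp⟩
      ⟨pullback.snd _ _, by rw [hp]; apply Limits.prod.hom_ext <;> simp⟩
    exact ⟨{
      right_cancellation := fun _ f g h₁ h₂ => (cancel_mono m).1
        (Limits.prod.hom_ext (by simpa using h₁) (by simpa using h₂))
      c := pullback.cone (m ≫ prod.snd) (m ≫ prod.fst)
      isLimit := pullback.isLimit (m ≫ prod.snd) (m ≫ prod.fst)
      t := t
      transitivity₁ := by rw [← Category.assoc, ht, prod.lift_fst]; rfl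
      transitivity₂ := by rw [← Category.assoc, ht, prod.lift_snd]; rfl }⟩

lemma ofMono_pair {X R : C} (m : R ⟶ X ⨯ X) [Mono m] (refl) (trans) :
    (ofMono m refl trans).pair = m := by
  apply Limits.prod.hom_ext
  · exact prod.lift_fst _ _
  · exact prod.lift_snd _ _

lemma ofMono_le_iff {X R : C} (m : R ⟶ X ⨯ X) [Mono m] (refl) (trans) {T : C} (a b : T ⟶ X) :
    (ofMono m refl trans).Le a b ↔ ∃ r : T ⟶ R, r ≫ m = prod.lift a b := by
  have := le_iff_pair (A := ofMono m refl trans) (T := T) a b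
  rwa [ofMono_pair] at this

/-- The arrow `X × X ⟶ (A × A) × (B × B)` induced by arrows `X ⟶ A` and `X ⟶ B`. -/
def jointSquare {X Y Z : C} (f : X ⟶ Y) (g : X ⟶ Z) : X ⨯ X ⟶ (Y ⨯ Y) ⨯ (Z ⨯ Z) :=
  prod.lift (prod.map f f) (prod.map g g)

/-- A single pullback over `(A × A) × (B × B)` gives the intersection of the two inverse image
relations on `X`. -/
lemma exists_jointSquare_lift_iff {X : C} (f : X ⟶ A.carrier) (g : X ⟶ B.carrier) {T : C}
    (a b : T ⟶ X) :
    (∃ r : T ⟶ pullback (jointSquare f g) (prod.map A.pair B.pair),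
      r ≫ pullback.fst (jointSquare f g) (prod.map A.pair B.pair) = prod.lift a b) ↔
      A.Le (a ≫ f) (b ≫ f) ∧ B.Le (a ≫ g) (b ≫ g) := by
  rw [le_iff_pair, le_iff_pair]
  constructor
  · rintro ⟨r, hr⟩
    obtain ⟨s, hs⟩ : ∃ s, prod.lift a b ≫ jointSquare f g = s ≫ prod.map A.pair B.pair :=
      ⟨r ≫ pullback.snd _ _, by rw [← hr, Category.assoc, pullback.condition, Category.assoc]⟩
    exact ⟨⟨s ≫ prod.fst, by simpa [jointSquare] using congr($hs ≫ prod.fst).symm⟩,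
      ⟨s ≫ prod.snd, by simpa [jointSquare] using congr($hs ≫ prod.snd).symm⟩⟩
  · rintro ⟨⟨r, hr⟩, ⟨s, hs⟩⟩
    refine ⟨pullback.lift (prod.lift a b) (prod.lift r s) ?_, pullback.lift_fst _ _ _⟩
    apply Limits.prod.hom_ext <;> simp [jointSquare, hr, hs]

/-- The coarsest preorder on `X` making two arrows out of `X` monotone. -/
def joint (A B : InternalPreorder C) {X : C} (f : X ⟶ A.carrier) (g : X ⟶ B.carrier) :
    InternalPreorder C :=
  ofMono (pullback.fst (jointSquare f g) (prod.map A.pair B.pair))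
    ((exists_jointSquare_lift_iff f g _ _).2 ⟨.refl _, .refl _⟩) fun a b c hab hbc => by
      rw [exists_jointSquare_lift_iff] at hab hbc ⊢
      exact ⟨hab.1.trans hbc.1, hab.2.trans hbc.2⟩

lemma joint_le_iff {X : C} (f : X ⟶ A.carrier) (g : X ⟶ B.carrier) {T : C}
    (a b : T ⟶ X) :
    (joint A B f g).Le a b ↔ A.Le (a ≫ f) (b ≫ f) ∧ B.Le (a ≫ g) (b ≫ g) :=
  (ofMono_le_iff _ _ _ a b).trans (exists_jointSquare_lift_iff f g a b)

/-- The first projection from the joint preorder. -/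
def jointFst {X : C} (f : X ⟶ A.carrier) (g : X ⟶ B.carrier) : joint A B f g ⟶ A :=
  homMk f ((joint_le_iff f g _ _).1 (le_r _)).1

/-- The second projection from the joint preorder. -/
def jointSnd {X : C} (f : X ⟶ A.carrier) (g : X ⟶ B.carrier) : joint A B f g ⟶ B :=
  homMk g ((joint_le_iff f g _ _).1 (le_r _)).2

/-- The arrow between underlying objects of a pullback of preorders is a pullback. -/
lemma isPullback_base {P X Y Z : InternalPreorder C} {k : P ⟶ X} {f : P ⟶ Y} {g : X ⟶ Z}
    {h : Y ⟶ Z} (sq : IsPullback k f g h) : IsPullback k.base f.base g.base h.base := by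
  refine IsPullback.of_exists_lift (congr_base sq.w) (fun {T} a b w => ?_)
    fun {T} l l' h₁ h₂ => ?_
  -- Arrows `T ⟶ A.carrier` are the morphisms from the discrete preorder on `T`, so the universal
  -- property in `PreOrd(C)` can be applied to them.
  · refine ⟨(sq.lift (discreteHom a) (discreteHom b) (hom_ext w)).base, ?_, ?_⟩
    · exact congr_base (sq.lift_fst (discreteHom a) (discreteHom b) _)
    · exact congr_base (sq.lift_snd (discreteHom a) (discreteHom b) _)
  · exact congr_base (sq.hom_ext (hom_ext h₁ : discreteHom l ≫ k = discreteHom l' ≫ k)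
      (hom_ext h₂ : discreteHom l ≫ f = discreteHom l' ≫ f))

/-- In a pullback of preorders, the preorder is induced by the projections. -/
lemma le_of_isPullback {P X Y Z : InternalPreorder C} {k : P ⟶ X} {f : P ⟶ Y} {g : X ⟶ Z}
    {h : Y ⟶ Z} (sq : IsPullback k f g h) {T : C} {a b : T ⟶ P.carrier}
    (hX : X.Le (a ≫ k.base) (b ≫ k.base)) (hY : Y.Le (a ≫ f.base) (b ≫ f.base)) : P.Le a b := by
  -- The carrier of `P` with the joint preorder is a competing cone. Its comparison with `P` has
  -- identity base, so the joint preorder is contained in that of `P`.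
  have w : jointFst k.base f.base ≫ g = jointSnd k.base f.base ≫ h := hom_ext
    (show k.base ≫ g.base = f.base ≫ h.base from congr_base sq.w)
  have hj : (sq.lift _ _ w).base = 𝟙 P.carrier := (isPullback_base sq).hom_ext
    ((congr_base (sq.lift_fst _ _ w)).trans (Category.id_comp _).symm)
    ((congr_base (sq.lift_snd _ _ w)).trans (Category.id_comp _).symm)
  have : P.Le (a ≫ 𝟙 P.carrier) (b ≫ 𝟙 P.carrier) := by
    rw [← hj]
    exact ((joint_le_iff k.base f.base a b).2 ⟨hX, hY⟩).map (sq.lift _ _ w)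
  simpa using this

end

section

variable {C : Type u} [Category.{v} C] [HasFiniteLimits C] {A : InternalPreorder C}

/-- The preorder on generalized elements is local for strong epimorphisms. -/
lemma Le.of_strongEpi {S T : C} {a b : T ⟶ A.carrier} (p : S ⟶ T) [StrongEpi p]
    (h : A.Le (p ≫ a) (p ≫ b)) : A.Le a b := by
  rw [le_iff_pair] at h ⊢
  obtain ⟨r, hr⟩ := h
  have sq : CommSq r p A.pair (prod.lift a b) := ⟨by simp [hr]⟩
  exact ⟨sq.lift, sq.fac_right⟩

end

/-! ### The quotient by `∼ρ` and the reflection into partial orders. -/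

noncomputable section

variable {C : Type u} [Category.{v} C] [BarrExact C] {A B : InternalPreorder C}

/-- Generalized elements lift along strong epimorphisms after passing to a cover. -/
lemma exists_lift_strongEpi {X Y T : C} (q : X ⟶ Y) [StrongEpi q] (y : T ⟶ Y) :
    ∃ (S : C) (p : S ⟶ T) (x : S ⟶ X), StrongEpi p ∧ p ≫ y = x ≫ q :=
  ⟨_, pullback.snd q y, pullback.fst q y, inferInstance, pullback.condition.symm⟩

instance (A : InternalPreorder C) : IsRegularEpi A.quotπ :=
  inferInstanceAs (IsRegularEpi (coequalizer.π A.sim₁ A.sim₂))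

lemma sim_quotπ (A : InternalPreorder C) : A.sim₁ ≫ A.quotπ = A.sim₂ ≫ A.quotπ :=
  coequalizer.condition _ _

/-- The relation `∼ρ` is the kernel pair of the quotient map. -/
lemma comp_quotπ_eq_iff {T : C} (a b : T ⟶ A.carrier) :
    a ≫ A.quotπ = b ≫ A.quotπ ↔ A.Equiv a b := by
  rw [equiv_iff_sim]
  constructor
  · intro h
    obtain ⟨e⟩ := A.sim_equivalence
    obtain ⟨Y, f, hf⟩ := BarrExact.effective _ _ e.isEquivalenceRelation
    -- An arrow `f` with kernel pair `∼ρ` factors through the quotient, so elements identified by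
    -- `quotπ` are identified by `f`, hence equivalent.
    obtain ⟨d, hf'⟩ : ∃ d : A.quot ⟶ Y, A.quotπ ≫ d = f :=
      ⟨coequalizer.desc f hf.w, coequalizer.π_desc _ _⟩
    have hab : a ≫ f = b ≫ f := by
      rw [← hf', ← Category.assoc, h, Category.assoc]
    exact ⟨hf.lift a b hab, hf.lift_fst _ _ _, hf.lift_snd _ _ _⟩
  · rintro ⟨l, rfl, rfl⟩
    rw [Category.assoc, Category.assoc, sim_quotπ]

/-- The arrow `ρ ⟶ A/∼ρ × A/∼ρ` whose image is the order of the quotient. -/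
def quotPair (A : InternalPreorder C) : A.rel ⟶ A.quot ⨯ A.quot :=
  A.pair ≫ prod.map A.quotπ A.quotπ

/-- Taking the image creates no new comparisons between elements of `A`: on a cover, one in the
image comes from `ρ` with endpoints equivalent to `a` and `b`, and transitivity absorbs the
equivalences. -/
lemma exists_quotPair_lift_iff {T : C} (a b : T ⟶ A.carrier) :
    (∃ r : T ⟶ (Regular.strongEpiMonoFactorisation A.quotPair).I,
      r ≫ (Regular.strongEpiMonoFactorisation A.quotPair).m =
        prod.lift (a ≫ A.quotπ) (b ≫ A.quotπ)) ↔ A.Le a b := by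
  have fac := (Regular.strongEpiMonoFactorisation A.quotPair).fac
  constructor
  · rintro ⟨r, hr⟩
    obtain ⟨S, p, s, hp, hs⟩ :=
      exists_lift_strongEpi (Regular.strongEpiMonoFactorisation A.quotPair).e r
    have w : s ≫ A.quotPair = p ≫ prod.lift (a ≫ A.quotπ) (b ≫ A.quotπ) := by
      rw [← fac, ← Category.assoc, ← hs, Category.assoc, hr]
    have h₁ : (s ≫ A.r₁) ≫ A.quotπ = (p ≫ a) ≫ A.quotπ := by
      simpa [quotPair, pair] using congr($w ≫ prod.fst)
    have h₂ : (s ≫ A.r₂) ≫ A.quotπ = (p ≫ b) ≫ A.quotπ := by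
      simpa [quotPair, pair] using congr($w ≫ prod.snd)
    rw [comp_quotπ_eq_iff] at h₁ h₂
    exact .of_strongEpi p ((h₁.2.trans (A.le_r.comp s)).trans h₂.1)
  · rintro ⟨r, rfl, rfl⟩
    refine ⟨r ≫ (Regular.strongEpiMonoFactorisation A.quotPair).e, ?_⟩
    rw [Category.assoc, fac]
    simp [quotPair, pair]

/-- The preorder `A/∼ρ` with the image of `ρ`. -/
def reflection (A : InternalPreorder C) : InternalPreorder C :=
  ofMono (Regular.strongEpiMonoFactorisation A.quotPair).m
    (by
      obtain ⟨r, hr⟩ := (exists_quotPair_lift_iff (𝟙 A.carrier) (𝟙 A.carrier)).2 (.refl _)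
      -- Reflexivity descends along the strong epimorphism `quotπ` by a diagonal filler.
      have sq : CommSq r A.quotπ (Regular.strongEpiMonoFactorisation A.quotPair).m
          (prod.lift (𝟙 _) (𝟙 _)) := ⟨by rw [hr]; simp⟩
      exact ⟨sq.lift, sq.fac_right⟩)
    fun x y z hxy hyz => by
      -- Three successive covers provide representatives of `x`, `y`, `z`; transitivity is used in
      -- `A`, then descended by a filler along the composite cover.
      obtain ⟨S, p, a, hp, ha⟩ := exists_lift_strongEpi A.quotπ x
      obtain ⟨S', p', b, hp', hb⟩ := exists_lift_strongEpi A.quotπ (p ≫ y)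
      obtain ⟨S'', p'', c, hp'', hc⟩ := exists_lift_strongEpi A.quotπ (p' ≫ p ≫ z)
      obtain ⟨r, hr⟩ := hxy
      obtain ⟨s, hs⟩ := hyz
      have hab : A.Le (p'' ≫ p' ≫ a) (p'' ≫ b) := (exists_quotPair_lift_iff _ _).1
        ⟨p'' ≫ p' ≫ p ≫ r, by simp [hr, ha, ← hb]⟩
      have hbc : A.Le (p'' ≫ b) c := (exists_quotPair_lift_iff _ _).1
        ⟨p'' ≫ p' ≫ p ≫ s, by simp [hs, ← hb, ← hc]⟩
      obtain ⟨t, ht⟩ := (exists_quotPair_lift_iff _ _).2 (hab.trans hbc)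
      have sq : CommSq t ((p'' ≫ p') ≫ p) (Regular.strongEpiMonoFactorisation A.quotPair).m
          (prod.lift x z) := ⟨by rw [ht]; simp [ha, ← hc]⟩
      have := strongEpi_comp p'' p'
      have := strongEpi_comp (p'' ≫ p') p
      exact ⟨sq.lift, sq.fac_right⟩

/-- The quotient map reflects the preorder. -/
lemma reflection_le_iff {T : C} (a b : T ⟶ A.carrier) :
    A.reflection.Le (a ≫ A.quotπ) (b ≫ A.quotπ) ↔ A.Le a b :=
  (ofMono_le_iff _ _ _ _ _).trans (exists_quotPair_lift_iff a b)

/-- The unit of the reflection. -/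
def toReflection (A : InternalPreorder C) : A ⟶ A.reflection :=
  homMk (B := A.reflection) A.quotπ ((reflection_le_iff _ _).2 A.le_r)

instance (A : InternalPreorder C) : IsRegularEpi A.toReflection.base :=
  inferInstanceAs (IsRegularEpi A.quotπ)

lemma le_toReflection_iff {T : C} (a b : T ⟶ A.carrier) :
    A.reflection.Le (a ≫ A.toReflection.base) (b ≫ A.toReflection.base) ↔ A.Le a b :=
  reflection_le_iff a b

lemma comp_toReflection_eq_iff {T : C} (a b : T ⟶ A.carrier) :
    a ≫ A.toReflection.base = b ≫ A.toReflection.base ↔ A.Equiv a b :=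
  comp_quotπ_eq_iff a b

/-- On a cover, equivalent elements have representatives in `A`. The unit reflects the order, so
these are equivalent and the quotient already identifies them. -/
lemma isPartialOrder_reflection (A : InternalPreorder C) : isPartialOrder C A.reflection := by
  refine isPartialOrder_iff.2 fun {T} x y h => ?_
  obtain ⟨S, p, a, hp, ha⟩ := exists_lift_strongEpi A.toReflection.base x
  obtain ⟨S', p', b, hp', hb⟩ := exists_lift_strongEpi A.toReflection.base (p ≫ y)
  have h' : A.Equiv (p' ≫ a) b := by
    rw [Equiv, ← le_toReflection_iff (p' ≫ a), ← le_toReflection_iff b, ← hb, Category.assoc, ← ha]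
    exact ⟨(h.1.comp p).comp p', (h.2.comp p).comp p'⟩
  rw [← comp_toReflection_eq_iff, ← hb, Category.assoc, ← ha] at h'
  exact (cancel_epi p).1 ((cancel_epi p').1 h')

/-- Monotonicity of an arrow out of the reflection can be tested on the original preorder. -/
lemma le_of_toReflection {T : C} {f : A.reflection.carrier ⟶ B.carrier} (g : A ⟶ B)
    (w : A.toReflection.base ≫ f = g.base) {x y : T ⟶ A.reflection.carrier}
    (h : A.reflection.Le x y) : B.Le (x ≫ f) (y ≫ f) := by
  obtain ⟨S, p, a, hp, ha⟩ := exists_lift_strongEpi A.toReflection.base x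
  obtain ⟨S', p', b, hp', hb⟩ := exists_lift_strongEpi A.toReflection.base (p ≫ y)
  have hab : A.Le (p' ≫ a) b := by
    rw [← le_toReflection_iff, ← hb, Category.assoc, ← ha]
    exact (h.comp p).comp p'
  refine .of_strongEpi p (.of_strongEpi p' ?_)
  have ha' := congr(p' ≫ $ha ≫ f)
  have hb' := congr($hb ≫ f)
  simp only [Category.assoc, w] at ha' hb'
  rw [ha', hb', ← Category.assoc]
  exact hab.map g

/-- The reflection is universal among morphisms to partial orders. -/
lemma toReflection_bijective (A : InternalPreorder C) {P : InternalPreorder C}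
    (hP : isPartialOrder C P) :
    Function.Bijective fun g : A.reflection ⟶ P => A.toReflection ≫ g := by
  constructor
  · intro g g' h
    exact hom_ext ((cancel_epi A.toReflection.base).1 (congr_base h))
  · intro g
    let f : A.quot ⟶ P.carrier := coequalizer.desc g.base
      (isPartialOrder_iff.1 hP _ _ (A.equiv_sim.map g))
    have w : A.toReflection.base ≫ f = g.base := coequalizer.π_desc _ _
    exact ⟨homMk (A := A.reflection) f (le_of_toReflection g w (le_r _)), hom_ext w⟩

variable (C) in
/-- The inclusion of partial orders into preorders has a left adjoint. -/
lemma forgetParOrd_isRightAdjoint : (forgetParOrd C).IsRightAdjoint :=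
  (Adjunction.adjunctionOfEquivLeft
    (F_obj := fun A => (⟨A.reflection, A.isPartialOrder_reflection⟩ : ParOrd C))
    (fun A P => (isPartialOrder C).fullyFaithfulι.homEquiv.trans
      (Equiv.ofBijective _ (A.toReflection_bijective P.property)))
    fun A _ _ g h => (Category.assoc A.toReflection h.hom g.hom).symm).isRightAdjoint

/-- The action of the reflection on morphisms. -/
def reflectionMap (f : A ⟶ B) : A.reflection ⟶ B.reflection :=
  homMk (A := A.reflection) (quotMap f)
    (le_of_toReflection (B := B.reflection) (f ≫ B.toReflection) (quotπ_quotMap f) (le_r _))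

lemma toReflection_reflectionMap (f : A ⟶ B) :
    A.toReflection ≫ reflectionMap f = f ≫ B.toReflection :=
  hom_ext (quotπ_quotMap f)

/-! ### Morphisms inverted by the reflector. -/

section

variable {F : InternalPreorder C ⥤ ParOrd C} (adj : F ⊣ forgetParOrd C)

include adj

/-- A morphism is inverted by the reflector if and only if partial orders are local for it. -/
lemma classE_iff (f : A ⟶ B) : classE F f ↔ ∀ {P : InternalPreorder C}, isPartialOrder C P →
    Function.Bijective fun g : B ⟶ P => f ≫ g := by
  refine (isIso_iff_coyoneda_map_bijective (F.map f)).trans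
    ⟨fun h P hP => ?_, fun h P => ?_⟩
  · exact (adj.map_comp_bijective_iff f ⟨P, hP⟩).1 (h _)
  · exact (adj.map_comp_bijective_iff f P).2 (h P.property)

lemma classE_toReflection (A : InternalPreorder C) : classE F A.toReflection :=
  (classE_iff adj _).2 fun hP => A.toReflection_bijective hP

/-- A morphism is inverted by any reflector if and only if its explicit reflection is invertible. -/
lemma classE_iff_isIso_reflectionMap (f : A ⟶ B) : classE F f ↔ IsIso (reflectionMap f) := by
  have : (classE F).HasTwoOutOfThreeProperty :=
    inferInstanceAs ((MorphismProperty.isomorphisms (ParOrd C)).inverseImage F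
      ).HasTwoOutOfThreeProperty
  -- Two-out-of-three in the naturality square of the unit reduces the claim to `reflectionMap f`.
  rw [← (classE F).postcomp_iff (W' := classE F) f B.toReflection (classE_toReflection adj B),
    ← toReflection_reflectionMap,
    (classE F).precomp_iff (W' := classE F) A.toReflection _ (classE_toReflection adj A)]
  refine ⟨fun h => ?_, fun h => inferInstanceAs (IsIso (F.map (reflectionMap f)))⟩
  -- Both ends of `reflectionMap f` are partial orders, so locality at the source gives a retraction
  -- and locality at the target makes it an inverse.
  obtain ⟨d, hd⟩ := ((classE_iff adj _).1 h A.isPartialOrder_reflection).2 (𝟙 _)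
  dsimp only at hd
  refine ⟨d, hd, ((classE_iff adj _).1 h B.isPartialOrder_reflection).1 ?_⟩
  dsimp only
  rw [← Category.assoc, hd, Category.id_comp, Category.comp_id]

/-- Full faithfulness of `f` and surjectivity of the induced arrow between quotients characterize
the morphisms inverted by the reflector. -/
theorem classE_iff_isFullyFaithful (f : A ⟶ B) :
    classE F f ↔ IsFullyFaithful f ∧ IsRegularEpi (quotMap f) := by
  have w := congr_base (toReflection_reflectionMap f)
  simp only [comp_base] at w
  have hle {T : C} (a b : T ⟶ A.carrier) : B.Le (a ≫ f.base) (b ≫ f.base) ↔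
      B.reflection.Le ((a ≫ A.toReflection.base) ≫ (reflectionMap f).base)
        ((b ≫ A.toReflection.base) ≫ (reflectionMap f).base) := by
    rw [Category.assoc, Category.assoc, w, ← Category.assoc, ← Category.assoc,
      le_toReflection_iff]
  have hq : IsRegularEpi (quotMap f) ↔ IsRegularEpi (reflectionMap f).base := Iff.rfl
  rw [classE_iff_isIso_reflectionMap adj, isFullyFaithful_iff, hq]
  constructor
  · intro h
    refine ⟨fun a b hab => ?_, ?_⟩
    · rw [hle] at hab
      have := hab.map (inv (reflectionMap f))
      simp only [Category.assoc, ← comp_base, IsIso.hom_inv_id] at this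
      exact (le_toReflection_iff a b).1 (by simpa using this)
    · infer_instance
  · rintro ⟨h, he⟩
    -- Representatives of elements with equal images are comparable both ways after `f`; full
    -- faithfulness makes them equivalent in `A`.
    have : Mono (reflectionMap f).base := ⟨fun {T} x y hxy => by
      obtain ⟨S, p, a, hp, ha⟩ := exists_lift_strongEpi A.toReflection.base x
      obtain ⟨S', p', b, hp', hb⟩ := exists_lift_strongEpi A.toReflection.base (p ≫ y)
      have hab : ((p' ≫ a) ≫ A.toReflection.base) ≫ (reflectionMap f).base =
          (b ≫ A.toReflection.base) ≫ (reflectionMap f).base := by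
        rw [← hb, Category.assoc p' a, ← ha]
        simp [hxy]
      have : A.Equiv (p' ≫ a) b :=
        ⟨h _ _ ((hle _ _).2 (hab ▸ .refl _)), h _ _ ((hle _ _).2 (hab ▸ .refl _))⟩
      rw [← comp_toReflection_eq_iff, ← hb, Category.assoc, ← ha] at this
      exact (cancel_epi p).1 ((cancel_epi p').1 this)⟩
    have := isIso_of_mono_of_strongEpi (reflectionMap f).base
    -- An invertible base is not enough: the inverse must also be monotone.
    refine isIso_of_reflects_le _ fun {T} x y hxy => ?_
    obtain ⟨S, p, a, hp, ha⟩ := exists_lift_strongEpi A.toReflection.base x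
    obtain ⟨S', p', b, hp', hb⟩ := exists_lift_strongEpi A.toReflection.base (p ≫ y)
    refine .of_strongEpi p (.of_strongEpi p' ?_)
    have := (hxy.comp p).comp p'
    rw [ha, hb, ← Category.assoc]
    rw [le_toReflection_iff]
    refine h _ _ ((hle _ _).2 ?_)
    rw [← hb, Category.assoc p' a, ← ha]
    simpa using this

end

end

/-! ### Discrete fibrations of equivalence relations. -/

section

variable {C : Type u} [Category.{v} C] [HasFiniteLimits C] {A B : InternalPreorder C}

/-- Discrete fibrations between the equivalence relations, on generalized elements. -/
lemma isDiscreteFibration_simMap_iff (f : A ⟶ B) :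
    IsDiscreteFibration (simMap f) ↔
      (∀ {T : C} (a : T ⟶ A.carrier) (b : T ⟶ B.carrier), B.Equiv (a ≫ f.base) b →
        ∃ a' : T ⟶ A.carrier, A.Equiv a a' ∧ a' ≫ f.base = b) ∧
      ∀ {T : C} (a a' : T ⟶ A.carrier), A.Equiv a a' → a ≫ f.base = a' ≫ f.base → a = a' := by
  constructor
  · intro (h : IsPullback (Hom.simRel f) A.sim₂ B.sim₂ f.base)
    refine ⟨fun a b hab => ?_, fun a a' ha w => ?_⟩
    · obtain ⟨l, hl₁, hl₂⟩ := (equiv_iff_sim _ _).1 hab.symm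
      refine ⟨h.lift l a hl₂ ≫ A.sim₁, ?_, ?_⟩
      · exact Equiv.symm ((equiv_iff_sim _ _).2 ⟨_, rfl, h.lift_snd _ _ _⟩)
      · rw [Category.assoc, Hom.sim_w₁, ← Category.assoc, h.lift_fst, hl₁]
    · obtain ⟨l, rfl, rfl⟩ := (equiv_iff_sim _ _).1 ha
      obtain ⟨r, hr₁, hr₂⟩ := (equiv_iff_sim _ _).1 (Equiv.refl (l ≫ A.sim₂))
      -- The pair `l` and the reflexive pair at its second component have the same image in `∼σ` and
      -- the same codomain.
      have : l = r := h.hom_ext (sim_hom_ext ?_ ?_) hr₂.symm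
      · rw [← hr₁, ← this]
      · rw [Category.assoc, ← Hom.sim_w₁, ← Category.assoc, w, Category.assoc _ _ B.sim₁,
          ← Hom.sim_w₁, ← Category.assoc r, hr₁]
      · rw [Category.assoc, ← Hom.sim_w₂, ← Category.assoc, Category.assoc _ _ B.sim₂,
          ← Hom.sim_w₂, ← Category.assoc r, hr₂]
  · rintro ⟨ex, un⟩
    refine IsPullback.of_exists_lift (P := A.simObj) (Hom.sim_w₂ f).symm
      (fun {T} (s : T ⟶ B.simObj) (a : T ⟶ A.carrier) (w : s ≫ B.sim₂ = a ≫ f.base) => ?_)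
      fun {T} (l l' : T ⟶ A.simObj) (h₁ : l ≫ Hom.simRel f = l' ≫ Hom.simRel f)
        (h₂ : l ≫ A.sim₂ = l' ≫ A.sim₂) => sim_hom_ext (un _ _ ?_ ?_) h₂
    · obtain ⟨a', ha, hb⟩ := ex a (s ≫ B.sim₁)
        (Equiv.symm ((equiv_iff_sim _ _).2 ⟨s, rfl, w⟩))
      obtain ⟨l, hl₁, hl₂⟩ := (equiv_iff_sim _ _).1 ha.symm
      refine ⟨l, sim_hom_ext ?_ ?_, hl₂⟩
      · change (l ≫ Hom.simRel f) ≫ _ = _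
        rw [Category.assoc, ← Hom.sim_w₁, ← Category.assoc, hl₁, hb]
      · change (l ≫ Hom.simRel f) ≫ _ = _
        rw [Category.assoc, ← Hom.sim_w₂, ← Category.assoc, hl₂, w]
    · have h : A.Equiv (l ≫ A.sim₁) (l ≫ A.sim₂) := (equiv_iff_sim _ _).2 ⟨l, rfl, rfl⟩
      have h' : A.Equiv (l' ≫ A.sim₁) (l' ≫ A.sim₂) := (equiv_iff_sim _ _).2 ⟨l', rfl, rfl⟩
      exact h.trans (h₂ ▸ h'.symm)
    · rw [Category.assoc, Hom.sim_w₁, ← Category.assoc, h₁, Category.assoc, ← Hom.sim_w₁,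
        Category.assoc]

/-- The square of first projections is a pullback as soon as that of second projections is. -/
lemma isPullback_sim₁_of_isDiscreteFibration {f : A ⟶ B} (h : IsDiscreteFibration (simMap f)) :
    IsPullback (Hom.simRel f) A.sim₁ B.sim₁ f.base := by
  -- Because `∼` is symmetric, the element-wise condition does not distinguish the two projections.
  obtain ⟨ex, un⟩ := (isDiscreteFibration_simMap_iff f).1 h
  refine IsPullback.of_exists_lift (Hom.sim_w₁ f).symm
    (fun s a w => ?_) fun l l' h₁ h₂ => sim_hom_ext h₂ (un _ _ ?_ ?_)
  · obtain ⟨a', ha, hb⟩ := ex a (s ≫ B.sim₂) ((equiv_iff_sim _ _).2 ⟨s, w, rfl⟩)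
    obtain ⟨l, hl₁, hl₂⟩ := (equiv_iff_sim _ _).1 ha
    refine ⟨l, sim_hom_ext ?_ ?_, hl₁⟩
    · rw [Category.assoc, ← Hom.sim_w₁, ← Category.assoc, hl₁, w]
    · rw [Category.assoc, ← Hom.sim_w₂, ← Category.assoc, hl₂, hb]
  · have h : A.Equiv (l ≫ A.sim₁) (l ≫ A.sim₂) := (equiv_iff_sim _ _).2 ⟨l, rfl, rfl⟩
    have h' : A.Equiv (l' ≫ A.sim₁) (l' ≫ A.sim₂) := (equiv_iff_sim _ _).2 ⟨l', rfl, rfl⟩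
    exact h.symm.trans (h₂ ▸ h')
  · rw [Category.assoc, Hom.sim_w₂, ← Category.assoc, h₁, Category.assoc, ← Hom.sim_w₂,
      Category.assoc]

end

/-! ### The class `ℳ`. -/

noncomputable section

variable {C : Type u} [Category.{v} C] [BarrExact C] {A B : InternalPreorder C}

/-- Pullbacks of morphisms of partial orders are discrete fibrations of equivalence relations. -/
lemma isDiscreteFibration_of_classM {f : A ⟶ B} (hf : classM C f) :
    IsDiscreteFibration (simMap f) := by
  obtain ⟨P, Q, g, k, h, ⟨hP, hQ⟩, sq⟩ := hf
  rw [isPartialOrder_iff] at hP hQ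
  have sq' := isPullback_base sq
  refine (isDiscreteFibration_simMap_iff f).2 ⟨fun a b hab => ?_, fun a a' ha w => ?_⟩
  -- Antisymmetry of `Q` turns the equivalence into an equality, so `a ≫ k.base` and `b` define an
  -- element of the pullback, which is the required lift.
  · have w : (a ≫ k.base) ≫ g.base = b ≫ h.base := by
      rw [Category.assoc, sq'.w, ← Category.assoc]
      exact hQ _ _ (hab.map h)
    refine ⟨sq'.lift (a ≫ k.base) b w, ⟨le_of_isPullback sq ?_ ?_, le_of_isPullback sq ?_ ?_⟩,
      sq'.lift_snd _ _ _⟩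
    · rw [sq'.lift_fst]
      exact .refl _
    · rw [sq'.lift_snd]
      exact hab.1
    · rw [sq'.lift_fst]
      exact .refl _
    · rw [sq'.lift_snd]
      exact hab.2
  · exact sq'.hom_ext (hP _ _ (ha.map k)) w

/-- A morphism inducing a discrete fibration of equivalence relations is the pullback of its
reflection. -/
lemma isPullback_toReflection {f : A ⟶ B} (hf : IsDiscreteFibration (simMap f)) :
    IsPullback A.toReflection f (reflectionMap f) B.toReflection := by
  obtain ⟨ex, un⟩ := (isDiscreteFibration_simMap_iff f).1 hf
  have w := congr_base (toReflection_reflectionMap f)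
  simp only [comp_base] at w
  -- The comparison with the pullback of underlying arrows: uniqueness of lifts makes it monic,
  -- existence makes it a strong epimorphism.
  let c := pullback.lift _ _ w
  have hc₁ : c ≫ pullback.fst _ _ = A.toReflection.base := pullback.lift_fst _ _ _
  have hc₂ : c ≫ pullback.snd _ _ = f.base := pullback.lift_snd _ _ _
  have : Mono c := ⟨fun a a' h => un a a'
    ((comp_toReflection_eq_iff a a').1 (by rw [← hc₁, ← Category.assoc, h, Category.assoc]))
    (by rw [← hc₂, ← Category.assoc, h, Category.assoc])⟩
  have : StrongEpi c := by
    obtain ⟨S, p, a, hp, ha⟩ := exists_lift_strongEpi A.toReflection.base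
      (pullback.fst (reflectionMap f).base B.toReflection.base)
    have h : B.Equiv (a ≫ f.base)
        (p ≫ pullback.snd (reflectionMap f).base B.toReflection.base) := by
      rw [← comp_toReflection_eq_iff, Category.assoc, Category.assoc, ← w, ← pullback.condition,
        ← Category.assoc, ← ha, Category.assoc]
    obtain ⟨a', haa', ha'⟩ := ex _ _ h
    have : a' ≫ c = p := by
      apply pullback.hom_ext
      · rw [Category.assoc, hc₁, ha, comp_toReflection_eq_iff]
        exact haa'.symm
      · rw [Category.assoc, hc₂, ha']
    -- The cover `p` of the pullback factors through `c`.
    have : StrongEpi (a' ≫ c) := this ▸ hp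
    exact strongEpi_of_strongEpi a' c
  have := isIso_of_mono_of_strongEpi c
  refine isPullback_of_base ?_ fun a b h _ => (le_toReflection_iff a b).1 h
  exact IsPullback.of_iso_pullback ⟨w⟩ (asIso c) hc₁ hc₂

/-- A discrete fibration is exhibited in `ℳ` by its own naturality square, a pullback of a morphism
between partial orders. -/
lemma classM_iff_isDiscreteFibration (f : A ⟶ B) :
    classM C f ↔ IsDiscreteFibration (simMap f) :=
  ⟨isDiscreteFibration_of_classM, fun h => MorphismProperty.pullbacks_mk _
    (isPullback_toReflection h) ⟨A.isPartialOrder_reflection, B.isPartialOrder_reflection⟩⟩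

lemma classM_iff_isPullback (f : A ⟶ B) :
    classM C f ↔ IsPullback (Hom.simRel f) A.sim₁ B.sim₁ f.base ∧
      IsPullback (Hom.simRel f) A.sim₂ B.sim₂ f.base := by
  rw [classM_iff_isDiscreteFibration]
  exact ⟨fun h => ⟨isPullback_sim₁_of_isDiscreteFibration h, h⟩, fun h => h.2⟩

/-! ### The factorization system. -/

section

variable {F : InternalPreorder C ⥤ ParOrd C} (adj : F ⊣ forgetParOrd C)

include adj

/-- It suffices to treat a morphism of partial orders `P ⟶ Q`. Locality at `P` gives the unique
diagonal, and locality at `Q` its compatibility with the lower edge. -/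
lemma isOrthogonal_of_classE_of_classM {X Y : InternalPreorder C} {e : A ⟶ B} {m : X ⟶ Y}
    (he : classE F e) (hm : classM C m) : IsOrthogonal e m := by
  obtain ⟨P, Q, g, k, h, ⟨hP, hQ⟩, sq⟩ := hm
  refine IsOrthogonal.of_isPullback (fun a b w => ?_) sq
  rw [classE_iff adj] at he
  obtain ⟨d, hd⟩ := (he hP).2 a
  dsimp only at hd
  refine ⟨d, ⟨hd, (he hQ).1 ?_⟩, fun d' hd' => (he hP).1 (hd'.1.trans hd.symm)⟩
  dsimp only
  rw [← w, ← hd, Category.assoc]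

/-- Every morphism factors through the pullback of its reflection along the unit. -/
lemma hasFactorization_classE_classM : (classE F).HasFactorization (classM C) where
  nonempty_mapFactorizationData {A B} f := by
    let k := pullback.fst (reflectionMap f).base B.toReflection.base
    let l := pullback.snd (reflectionMap f).base B.toReflection.base
    have hk : IsPullback k l (reflectionMap f).base B.toReflection.base := .of_hasPullback _ _
    have sq : IsPullback (jointFst k l) (jointSnd k l) (reflectionMap f) B.toReflection :=
      isPullback_of_base hk fun a b h₁ h₂ => (joint_le_iff k l a b).2 ⟨h₁, h₂⟩
    have : (classE F).HasTwoOutOfThreeProperty :=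
      inferInstanceAs ((MorphismProperty.isomorphisms (ParOrd C)).inverseImage F
        ).HasTwoOutOfThreeProperty
    -- The key point: this pullback of the unit of `B` is still inverted by `F`, because pullback
    -- preserves the reflection of the order and regular epimorphisms.
    have hE : classE F (jointFst k l) := by
      refine (classE_iff_isFullyFaithful adj _).2 ⟨(isFullyFaithful_iff _).2 fun a b h => ?_, ?_⟩
      · refine le_of_isPullback sq h ((le_toReflection_iff _ _).1 ?_)
        have := h.map (reflectionMap f)
        simp only [Category.assoc] at this ⊢
        rwa [← isPullback_base sq |>.w]
      · have w := quotπ_quotMap (jointFst k l)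
        have : IsRegularEpi (jointFst k l).base :=
          inferInstanceAs (IsRegularEpi (pullback.fst _ _))
        -- The composite equals the base of `jointFst k l` followed by a quotient map, so its last
        -- factor `quotMap (jointFst k l)` is a strong epimorphism.
        have : StrongEpi ((joint A.reflection B k l).quotπ ≫ quotMap (jointFst k l)) := by
          rw [w]
          exact strongEpi_comp _ _
        have := strongEpi_of_strongEpi (joint A.reflection B k l).quotπ (quotMap (jointFst k l))
        infer_instance
    refine ⟨{
      Z := joint A.reflection B k l
      i := sq.lift _ _ (toReflection_reflectionMap f)
      p := jointSnd k l
      fac := sq.lift_snd _ _ _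
      hi := ?_
      hp := MorphismProperty.pullbacks_mk _ sq
        ⟨A.isPartialOrder_reflection, B.isPartialOrder_reflection⟩ }⟩
    -- Composed with `jointFst k l`, the first factor becomes the unit of `A`.
    rw [← (classE F).postcomp_iff (W' := classE F) _ _ hE, sq.lift_fst]
    exact classE_toReflection adj A

theorem isFactorizationSystem_classE_classM :
    IsFactorizationSystem (classE F) (classM C) := by
  have : (classE F).RespectsIso :=
    inferInstanceAs ((MorphismProperty.isomorphisms (ParOrd C)).inverseImage F).RespectsIso
  have : (classM C).RespectsIso :=
    inferInstanceAs (MorphismProperty.pullbacks _).RespectsIso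
  exact .of_isOrthogonal (hasFactorization_classE_classM adj) fun e m he hm =>
    isOrthogonal_of_classE_of_classM adj he hm

end

end

end InternalPreorder

theorem mainTheorem5 {C : Type u} [Category.{v} C] [BarrExact C] :
    (InternalPreorder.forgetParOrd C).IsRightAdjoint ∧
    ∀ F : InternalPreorder C ⥤ InternalPreorder.ParOrd C,
      Nonempty (F ⊣ InternalPreorder.forgetParOrd C) →
      IsFactorizationSystem (InternalPreorder.classE F) (InternalPreorder.classM C) ∧
      (∀ {A B : InternalPreorder C} (f : A ⟶ B),
        InternalPreorder.classE F f ↔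
          InternalPreorder.IsFullyFaithful f ∧ IsRegularEpi (InternalPreorder.quotMap f)) ∧
      (∀ {A B : InternalPreorder C} (f : A ⟶ B),
        (InternalPreorder.classM C f ↔
          IsPullback (InternalPreorder.Hom.simRel f) A.sim₁ B.sim₁ f.base ∧
          IsPullback (InternalPreorder.Hom.simRel f) A.sim₂ B.sim₂ f.base) ∧
        (InternalPreorder.classM C f ↔
          InternalPreorder.IsDiscreteFibration (InternalPreorder.simMap f))) :=
  ⟨InternalPreorder.forgetParOrd_isRightAdjoint C, fun _ ⟨adj⟩ =>
    ⟨InternalPreorder.isFactorizationSystem_classE_classM adj,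
      InternalPreorder.classE_iff_isFullyFaithful adj,
      fun f => ⟨InternalPreorder.classM_iff_isPullback f,
        InternalPreorder.classM_iff_isDiscreteFibration f⟩⟩⟩
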